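/- Let $k$ be a commutative integral domain and $X$ a non-empty set. Let $\mathfrak M(X)$ be the free operated monoid on $X$, i.e. the monoid (under concatenation) of bracketed words: the finite sequences, including the empty word $1$, of elements of $X\sqcup\lfloor \mathfrak M(X)\rfloor$, with operator $u\mapsto\lfloor u\rfloor$. For $u\in\mathfrak M(X)$ the breadth $|u|$ is the number of its factors in $X\sqcup\lfloor \mathfrak M(X)\rfloor$. Let $k\mathfrak M(X)$ be the monoid algebra, with the operator extended linearly. Let $\mathfrak M^\star(X)$ be the set of bracketed words on $X\sqcup\{\star\}$ in which $\star$ occurs exactly once; for $q\in\mathfrak M^\star(X)$ and $u\in\mathfrak M(X)$ let $q|_u$ be the word obtained from $q$ by replacing $\star$ by $u$, and extend $q|_u$ linearly to $q|_s$ for $s\in k\mathfrak M(X)$. Let $\le$ be a monomial order on $\mathfrak M(X)$, that is, a well-order such that $u<v$ implies $q|_u<q|_v$ for all $q\in\mathfrak M^\star(X)$. For $s\in k\mathfrak M(X)\setminus k$ let $\bar s$ be the largest monomial appearing in $s$ (for $s \in k$ put $\bar s=1$), let $c_s$ be the coefficient of $\bar s$ in $s$, and let $R(s)=c_s\bar s-s$.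 Let $S\subseteq k\mathfrak M(X)$ be monic, i.e. $s\notin k$ and $c_s=1$ for every $s\in S$. Put $$\Pi_S=\{\,q|_{\bar s}\to q|_{R(s)} \mid s\in S,\ q\in\mathfrak M^\star(X)\,\},\qquad \mathrm{Irr}(S)=\mathfrak M(X)\setminus\{\,q|_{\bar s}\mid s\in S,\ q\in\mathfrak M^\star(X)\,\},$$ let $k\,\mathrm{Irr}(S)$ be the $k$-span of $\mathrm{Irr}(S)$, and let $\mathrm{Id}(S)$ be the smallest two-sided ideal of $k\mathfrak M(X)$ that contains $S$ and is closed under $\lfloor\ \rfloor$. The system $\Pi_S$ rewrites $f$ to $g$ in one step if for some rule $t\to v$ in $\Pi_S$ the coefficient $c_t$ of the monomial $t$ in $f$ is non-zero and $g=f-c_tt+c_tv$; let $\to^*$ be the reflexive-transitive closure. $\Pi_S$ is terminating if there is no infinite chain of one-step rewritings, confluent if whenever $f\to^*g$ and $f\to^*h$ there is $e$ with $g\to^*e$ and $h\to^*e$, and convergent if it is terminating and confluent. An element of $k\mathfrak M(X)$ is trivial modulo $(S,w)$ if it is a $k$-linear combination of elements $q|_s$ with $s\in S$, $q\in\mathfrak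 M^\star(X)$ and $q|_{\bar s}<w$. $S$ is a Gröbner–Shirshov basis if for all $f,g\in S$ (including $f=g$): (i) $f\mu-\nu g$ is trivial modulo $(S,w)$ whenever $w,\mu,\nu\in\mathfrak M(X)$ satisfy $w=\bar f\mu=\nu\bar g$ and $\max(|\bar f|,|\bar g|)<|w|<|\bar f|+|\bar g|$; and (ii) $f-q|_g$ is trivial modulo $(S,w)$ whenever $q\in\mathfrak M^\star(X)$ and $w=\bar f=q|_{\bar g}$. Then the following are equivalent: 1. $\Pi_S$ is convergent; 2. $\Pi_S$ is confluent; 3. $\mathrm{Id}(S)\cap k\,\mathrm{Irr}(S)=0$; 4. $k\mathfrak M(X)=\mathrm{Id}(S)\oplus k\,\mathrm{Irr}(S)$; 5. $S$ is a Gröbner–Shirshov basis in $k\mathfrak M(X)$. -/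

import Mathlib

universe u v w

/-- The bracketed words on `X`, i.e. the underlying set of the free operated monoid `𝔐(X)`.
A word is either the empty word `1`, or a letter `x ∈ X` followed by a word, or a bracket `⌊a⌋`
(with `a` a word) followed by a word.  Equivalently, it is a finite sequence of elements of
`X ⊔ ⌊𝔐(X)⌋`, which is the union of the finite stages `𝔐ₙ(X) = M(X ⊔ ⌊𝔐ₙ₋₁(X)⌋)`. -/
inductive BracketedWord (X : Type u) : Type u
  | nil : BracketedWord X
  | var (x : X) (r : BracketedWord X) : BracketedWord X
  | br (a r : BracketedWord X) : BracketedWord X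

namespace BracketedWord

variable {X : Type u}

/-- Concatenation of bracketed words. -/
def append : BracketedWord X → BracketedWord X → BracketedWord X
  | nil, b => b
  | var x r, b => var x (append r b)
  | br a r, b => br a (append r b)

instance : One (BracketedWord X) := ⟨nil⟩

instance : Mul (BracketedWord X) := ⟨append⟩

theorem append_nil (a : BracketedWord X) : append a nil = a := by
  induction a with
  | nil => rfl
  | var x r ih => simp only [append, ih]
  | br a r _ ih => simp only [append, ih]

theorem append_assoc (a b c : BracketedWord X) :
    append (append a b) c = append a (append b c) := by
  induction a with
  | nil => rfl
  | var x r ih => simp only [append, ih]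
  | br a r _ ih => simp only [append, ih]

/-- `𝔐(X)` is a monoid under concatenation. -/
instance : Monoid (BracketedWord X) where
  mul_assoc := append_assoc
  one_mul _ := rfl
  mul_one := append_nil

/-- The operator `a ↦ ⌊a⌋` of the operated monoid `𝔐(X)`. -/
def bracket (a : BracketedWord X) : BracketedWord X := br a 1

/-- The breadth `|a|`: the number of factors of `a` in `X ⊔ ⌊𝔐(X)⌋`. -/
def breadth : BracketedWord X → ℕ
  | nil => 0
  | var _ r => breadth r + 1
  | br _ r => breadth r + 1

/-- The number of occurrences (at any depth) of the extra letter `⋆ = none` in a bracketed word on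
`X ⊔ {⋆} = Option X`. -/
def starCount : BracketedWord (Option X) → ℕ
  | nil => 0
  | var none r => starCount r + 1
  | var (some _) r => starCount r
  | br a r => starCount a + starCount r

/-- Replace each occurrence of `⋆ = none` by the bracketed word `b`. -/
def substStar (b : BracketedWord X) : BracketedWord (Option X) → BracketedWord X
  | nil => 1
  | var none r => b * substStar b r
  | var (some x) r => var x (substStar b r)
  | br a r => br (substStar b a) (substStar b r)

end BracketedWord

/-- The `⋆`-bracketed words on `X`: the bracketed words on `X ⊔ {⋆}` with exactly one occurrence
of `⋆`. -/
def StarWord (X : Type u) : Type u :=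
  {q : BracketedWord (Option X) // BracketedWord.starCount q = 1}

/-- `q|_b`, for `q` a `⋆`-bracketed word and `b` a bracketed word. -/
def StarWord.plug {X : Type u} (q : StarWord X) (b : BracketedWord X) : BracketedWord X :=
  BracketedWord.substStar b q.1

/-- The algebra `k𝔐(X)` of bracketed polynomials. -/
abbrev BracketedPoly (k : Type v) (X : Type u) [CommRing k] : Type (max u v) :=
  MonoidAlgebra k (BracketedWord X)

/-- The given linear order on `𝔐(X)` is a monomial order. -/
structure IsMonomialOrder (X : Type u) [LinearOrder (BracketedWord X)] : Prop where
  wellFounded : WellFounded fun a b : BracketedWord X => a < b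
  plug_lt_plug : ∀ (a b : BracketedWord X) (q : StarWord X), a < b → q.plug a < q.plug b

/-! ### Term-rewriting systems on a free module `V` with basis `b` indexed by `W` -/

namespace TermRewriting

variable {k : Type u} {W : Type v} {V : Type w} [CommRing k] [AddCommGroup V] [Module k V]

/-- `R_t(f) = c_t t - f`, with `c_t` the coefficient of `t` in `f`. -/
noncomputable def rest (b : Module.Basis W k V) (t : W) (f : V) : V :=
  b.repr f t • b t - f

/-- One-step rewriting for the term-rewriting system `P ⊆ W × V`: for some rule `t → v` in `P` with
`t ∈ Supp(f)`, i.e. with `c_t ≠ 0`, the element `f = c_t t - R_t(f)` is replaced by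
`c_t v - R_t(f)`. -/
def OneStep (b : Module.Basis W k V) (P : Set (W × V)) (f g : V) : Prop :=
  ∃ t v, (t, v) ∈ P ∧ b.repr f t ≠ 0 ∧ g = b.repr f t • v - rest b t f

/-- The reflexive-transitive closure of one-step rewriting. -/
def Rewrites (b : Module.Basis W k V) (P : Set (W × V)) (f g : V) : Prop :=
  Relation.ReflTransGen (OneStep b P) f g

def Joinable (b : Module.Basis W k V) (P : Set (W × V)) (f g : V) : Prop :=
  ∃ h, Rewrites b P f h ∧ Rewrites b P g h

/-- There is no infinite chain of one-step rewritings. -/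
def Terminating (b : Module.Basis W k V) (P : Set (W × V)) : Prop :=
  ¬ ∃ f : ℕ → V, ∀ n, OneStep b P (f n) (f (n + 1))

def Confluent (b : Module.Basis W k V) (P : Set (W × V)) : Prop :=
  ∀ f g h, Rewrites b P f g → Rewrites b P f h → Joinable b P g h

def Convergent (b : Module.Basis W k V) (P : Set (W × V)) : Prop :=
  Terminating b P ∧ Confluent b P

end TermRewriting

namespace BracketedPoly

variable {k : Type v} {X : Type u} [CommRing k]

/-- The bracketed word `a` as an element of `k𝔐(X)`. -/
noncomputable def mono (k : Type v) {X : Type u} [CommRing k] (a : BracketedWord X) :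
    BracketedPoly k X :=
  MonoidAlgebra.single a 1

/-- The linear extension of `a ↦ ⌊a⌋` to `k𝔐(X)`. -/
noncomputable def bracket (f : BracketedPoly k X) : BracketedPoly k X :=
  MonoidAlgebra.mapDomain BracketedWord.bracket f

/-- `q|_f = ∑ cᵢ q|_{aᵢ}` for `f = ∑ cᵢ aᵢ`. -/
noncomputable def plug (q : StarWord X) (f : BracketedPoly k X) : BracketedPoly k X :=
  MonoidAlgebra.mapDomain q.plug f

/-- A `k`-submodule of `k𝔐(X)` is an operated ideal if it is a two-sided ideal that is closed under
the operator `⌊ ⌋`. -/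
structure IsOperatedIdeal (I : Submodule k (BracketedPoly k X)) : Prop where
  mul_mem_left : ∀ a f : BracketedPoly k X, f ∈ I → a * f ∈ I
  mul_mem_right : ∀ a f : BracketedPoly k X, f ∈ I → f * a ∈ I
  bracket_mem : ∀ f : BracketedPoly k X, f ∈ I → bracket f ∈ I

/-- `Id(S)`: the smallest operated ideal of `k𝔐(X)` that contains `S`. -/
noncomputable def operatedIdeal (S : Set (BracketedPoly k X)) : Submodule k (BracketedPoly k X) :=
  sInf {I | IsOperatedIdeal I ∧ S ⊆ (I : Set (BracketedPoly k X))}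

theorem isLeast_operatedIdeal (S : Set (BracketedPoly k X)) :
    IsLeast {I | IsOperatedIdeal I ∧ S ⊆ (I : Set (BracketedPoly k X))} (operatedIdeal S) := by
  refine ⟨⟨⟨?_, ?_, ?_⟩, ?_⟩, fun I hI => sInf_le hI⟩
  · intro a f hf
    rw [operatedIdeal, Submodule.mem_sInf] at hf ⊢
    exact fun I hI => hI.1.mul_mem_left a f (hf I hI)
  · intro a f hf
    rw [operatedIdeal, Submodule.mem_sInf] at hf ⊢
    exact fun I hI => hI.1.mul_mem_right a f (hf I hI)
  · intro f hf
    rw [operatedIdeal, Submodule.mem_sInf] at hf ⊢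
    exact fun I hI => hI.1.bracket_mem f (hf I hI)
  · intro s hs
    rw [SetLike.mem_coe, operatedIdeal, Submodule.mem_sInf]
    exact fun I hI => hI.2 hs

variable [LinearOrder (BracketedWord X)]

open Classical in
/-- The leading monomial: the largest monomial that appears in `s`.  It is `1` for `s = 0`, hence
for every `s ∈ k`. -/
noncomputable def leadingMonomial (s : BracketedPoly k X) : BracketedWord X :=
  if h : s.coeff.support.Nonempty then s.coeff.support.max' h else 1

/-- The coefficient of the leading monomial. -/
noncomputable def leadingCoeff (s : BracketedPoly k X) : k :=
  s.coeff (leadingMonomial s)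

/-- `s` is monic: it is not a constant and its leading coefficient is `1`. -/
def IsMonic (s : BracketedPoly k X) : Prop :=
  s ∉ Set.range (algebraMap k (BracketedPoly k X)) ∧ leadingCoeff s = 1

/-- `R(s) = c_s s̄ - s`. -/
noncomputable def remainder (s : BracketedPoly k X) : BracketedPoly k X :=
  leadingCoeff s • mono k (leadingMonomial s) - s

/-- The term-rewriting system `Π_S` of all rules `q|_{s̄} → q|_{R(s)}` with `s ∈ S` and `q` a
`⋆`-bracketed word. -/
def rewritingSystem (S : Set (BracketedPoly k X)) :
    Set (BracketedWord X × BracketedPoly k X) :=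
  {p | ∃ s ∈ S, ∃ q : StarWord X, p = (q.plug (leadingMonomial s), plug q (remainder s))}

/-- `Irr(S) = 𝔐(X) \ {q|_{s̄} | s ∈ S, q a ⋆-bracketed word}`. -/
def irr (S : Set (BracketedPoly k X)) : Set (BracketedWord X) :=
  {a | ∃ s ∈ S, ∃ q : StarWord X, q.plug (leadingMonomial s) = a}ᶜ

/-- `k Irr(S)`: the `k`-span of `Irr(S)`. -/
noncomputable def irrSpan (S : Set (BracketedPoly k X)) : Submodule k (BracketedPoly k X) :=
  Submodule.span k (mono k '' irr S)

/-- `f` is trivial modulo `(S, a)`: it is a `k`-linear combination of elements `q|_s` with `s ∈ S`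
and `q|_{s̄} < a`. -/
def IsTrivialMod (S : Set (BracketedPoly k X)) (a : BracketedWord X) (f : BracketedPoly k X) :
    Prop :=
  f ∈ Submodule.span k
    {g | ∃ s ∈ S, ∃ q : StarWord X, q.plug (leadingMonomial s) < a ∧ g = plug q s}

/-- `S` is a Gröbner–Shirshov basis: all intersection compositions `f μ - ν g` (where
`a = f̄ μ = ν ḡ` and `max(|f̄|, |ḡ|) < |a| < |f̄| + |ḡ|`) and all including compositions `f - q|_g`
(where `a = f̄ = q|_{ḡ}`) of elements `f, g ∈ S` are trivial modulo `(S, a)`. -/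
structure IsGroebnerShirshov (S : Set (BracketedPoly k X)) : Prop where
  intersection : ∀ f ∈ S, ∀ g ∈ S, ∀ a m n : BracketedWord X,
    a = leadingMonomial f * m → a = n * leadingMonomial g →
    max (leadingMonomial f).breadth (leadingMonomial g).breadth < a.breadth →
    a.breadth < (leadingMonomial f).breadth + (leadingMonomial g).breadth →
    IsTrivialMod S a (f * mono k m - mono k n * g)
  including : ∀ f ∈ S, ∀ g ∈ S, ∀ (a : BracketedWord X) (q : StarWord X),
    a = leadingMonomial f → a = q.plug (leadingMonomial g) →
    IsTrivialMod S a (f - plug q g)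

end BracketedPoly

/-!
Order-decreasing rewriting on a free module obeys Bergman's diamond lemma.  Reducing `f` changes it
by a multiple of a relator `t - v`, and `f` plus a multiple of a relator is joinable with `f`, so
confluence means that the span of the relators meets the normal forms only in `0`.  If all
ambiguities are resolvable, one relator per left-hand side spans all of them, and such a family is
triangular: the largest left-hand side survives in every combination.

For `Π_S` an ambiguity is a pair of occurrences of leading monomials in one bracketed word.  Nested
and intersecting occurrences give the including and intersection compositions in a context;
disjoint ones are always resolvable, since `f ḡ - f̄ g = f R(g) - R(f) g`.
-/

namespace TermRewriting

variable {k : Type u} {W : Type v} {V : Type w} [CommRing k] [AddCommGroup V] [Module k V]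
  {b : Module.Basis W k V} {P : Set (W × V)}

/-- The span of the relators `t - v` of the rules `t → v` in `P`, i.e. of the elements that the
system identifies with `0`. -/
def relatorSpan (b : Module.Basis W k V) (P : Set (W × V)) : Submodule k V :=
  Submodule.span k ((fun p : W × V => b p.1 - p.2) '' P)

/-- The module of normal forms: the span of the basis elements that are not the left-hand side of
a rule in `P`. -/
def normalForms (b : Module.Basis W k V) (P : Set (W × V)) : Submodule k V :=
  Submodule.span k (b '' {t | ∀ v, (t, v) ∉ P})

theorem mem_normalForms_iff {f : V} :
    f ∈ normalForms b P ↔ ∀ p ∈ P, b.repr f p.1 = 0 := by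
  rw [normalForms, Module.Basis.mem_span_image]
  refine ⟨fun h p hp => ?_, fun h t ht v hv => Finsupp.mem_support_iff.1 ht (h _ hv)⟩
  by_contra ht
  exact h (Finsupp.mem_support_iff.2 ht) p.2 hp

theorem relatorSpan_mono {P Q : Set (W × V)} (h : P ⊆ Q) : relatorSpan b P ≤ relatorSpan b Q :=
  Submodule.span_mono (Set.image_mono h)

theorem relator_mem_relatorSpan {t : W} {v : V} (h : (t, v) ∈ P) : b t - v ∈ relatorSpan b P :=
  Submodule.subset_span ⟨(t, v), h, rfl⟩

theorem oneStep_iff {f g : V} :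
    OneStep b P f g ↔ ∃ p ∈ P, b.repr f p.1 ≠ 0 ∧ g = f - b.repr f p.1 • (b p.1 - p.2) := by
  have sub_rest (t : W) (v : V) :
      b.repr f t • v - rest b t f = f - b.repr f t • (b t - v) := by
    rw [rest, smul_sub]
    abel
  simp only [OneStep, sub_rest, Prod.exists]

theorem sub_mem_relatorSpan_of_rewrites {f g : V} (h : Rewrites b P f g) :
    f - g ∈ relatorSpan b P := by
  induction h with
  | refl => rw [sub_self]; exact zero_mem _
  | @tail g _ _ step ih =>
    obtain ⟨p, hp, -, rfl⟩ := oneStep_iff.1 step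
    rw [← sub_add]
    exact add_mem ih (Submodule.smul_mem _ _ (relator_mem_relatorSpan hp))

theorem eq_of_rewrites_of_mem_normalForms {f g : V} (h : Rewrites b P f g)
    (hf : f ∈ normalForms b P) : g = f := by
  induction h with
  | refl => rfl
  | tail _ step ih =>
    subst ih
    obtain ⟨p, hp, hne, -⟩ := oneStep_iff.1 step
    exact absurd (mem_normalForms_iff.1 hf p hp) hne

theorem confluent_of_relatorSpan_inf_normalForms_eq_bot
    (hnf : ∀ f, ∃ g ∈ normalForms b P, Rewrites b P f g)
    (h : relatorSpan b P ⊓ normalForms b P = ⊥) : Confluent b P := by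
  intro f g₁ g₂ h₁ h₂
  obtain ⟨n₁, hn₁, hgn₁⟩ := hnf g₁
  obtain ⟨n₂, hn₂, hgn₂⟩ := hnf g₂
  have hrel : n₂ - n₁ ∈ relatorSpan b P := by
    have := sub_mem (sub_mem_relatorSpan_of_rewrites (h₁.trans hgn₁))
      (sub_mem_relatorSpan_of_rewrites (h₂.trans hgn₂))
    rwa [sub_sub_sub_cancel_left] at this
  obtain rfl : n₂ = n₁ := sub_eq_zero.1 <| (Submodule.mem_bot k).1 <|
    h ▸ Submodule.mem_inf.2 ⟨hrel, sub_mem hn₂ hn₁⟩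
  exact ⟨n₂, hgn₁, hgn₂⟩

theorem relatorSpan_sup_normalForms_eq_top (hnf : ∀ f, ∃ g ∈ normalForms b P, Rewrites b P f g) :
    relatorSpan b P ⊔ normalForms b P = ⊤ := by
  refine eq_top_iff.2 fun f _ => ?_
  obtain ⟨g, hg, hfg⟩ := hnf f
  exact Submodule.mem_sup.2 ⟨f - g, sub_mem_relatorSpan_of_rewrites hfg, g, hg, sub_add_cancel f g⟩

theorem Confluent.equivalence_joinable (hP : Confluent b P) : Equivalence (Joinable b P) :=
  Relation.equivalence_join (r := Relation.ReflTransGen (OneStep b P)) hP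

variable [LinearOrder W]

/-- The span of the basis elements below `t`. -/
def lowerSpan (b : Module.Basis W k V) (t : W) : Submodule k V :=
  Submodule.span k (b '' Set.Iio t)

/-- Every rule in `P` replaces a basis element by a combination of smaller ones. -/
def IsDecreasing (b : Module.Basis W k V) (P : Set (W × V)) : Prop :=
  ∀ p ∈ P, p.2 ∈ lowerSpan b p.1

/-- All ambiguities of `P` are resolvable in the sense of Bergman: the two results of rewriting a
basis element `t` in two ways differ by a combination of relators whose left-hand sides are below
`t`. -/
def IsResolvable (b : Module.Basis W k V) (P : Set (W × V)) : Prop :=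
  ∀ t v₁ v₂, (t, v₁) ∈ P → (t, v₂) ∈ P → v₁ - v₂ ∈ relatorSpan b {p ∈ P | p.1 < t}

theorem mem_lowerSpan_iff {t : W} {f : V} :
    f ∈ lowerSpan b t ↔ ∀ u, b.repr f u ≠ 0 → u < t := by
  simp only [lowerSpan, Module.Basis.mem_span_image, Set.subset_def, Finset.mem_coe,
    Finsupp.mem_support_iff, Set.mem_Iio]

theorem repr_eq_zero_of_mem_lowerSpan {t u : W} {f : V} (hf : f ∈ lowerSpan b t) (h : t ≤ u) :
    b.repr f u = 0 := by
  by_contra hne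
  exact h.not_gt (mem_lowerSpan_iff.1 hf u hne)

theorem lowerSpan_mono {t u : W} (h : t ≤ u) : lowerSpan b t ≤ lowerSpan b u :=
  Submodule.span_mono (Set.image_mono (Set.Iio_subset_Iio h))

theorem repr_sub_self {t : W} {v : V} (hv : v ∈ lowerSpan b t) : b.repr (b t - v) t = 1 := by
  simp [repr_eq_zero_of_mem_lowerSpan hv le_rfl]

theorem repr_sub_of_lt {t u : W} {v : V} (hv : v ∈ lowerSpan b t) (h : t < u) :
    b.repr (b t - v) u = 0 := by
  simp [repr_eq_zero_of_mem_lowerSpan hv h.le, Finsupp.single_eq_of_ne h.ne']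

theorem IsDecreasing.relatorSpan_le_lowerSpan (hP : IsDecreasing b P) (a : W) :
    relatorSpan b {p ∈ P | p.1 < a} ≤ lowerSpan b a := by
  refine Submodule.span_le.2 ?_
  rintro _ ⟨p, ⟨hp, hpa⟩, rfl⟩
  exact sub_mem (Submodule.subset_span ⟨p.1, hpa, rfl⟩) (lowerSpan_mono hpa.le (hP p hp))

theorem joinable_add_smul_relator {p : W × V} (hp : p ∈ P) (hv : p.2 ∈ lowerSpan b p.1) (c : k)
    (f : V) : Joinable b P (f + c • (b p.1 - p.2)) f := by
  have reduct (g : V) : Rewrites b P g (g - b.repr g p.1 • (b p.1 - p.2)) := by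
    by_cases h : b.repr g p.1 = 0
    · rw [h, zero_smul, sub_zero]
      exact .refl
    · exact .single (oneStep_iff.2 ⟨p, hp, h, rfl⟩)
  refine ⟨_, ?_, reduct f⟩
  have h := reduct (f + c • (b p.1 - p.2))
  rwa [map_add, map_smul, Finsupp.add_apply, Finsupp.smul_apply, repr_sub_self hv, smul_eq_mul,
    mul_one, add_smul, add_sub_add_right_eq_sub] at h

theorem Confluent.joinable_add_of_mem_relatorSpan (hconf : Confluent b P) (hP : IsDecreasing b P)
    {f : V} (hf : f ∈ relatorSpan b P) (g : V) : Joinable b P (g + f) g := by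
  have smul_mem : ∀ (c : k) (g : V), Joinable b P (g + c • f) g := by
    induction hf using Submodule.span_induction with
    | mem f hf =>
      obtain ⟨p, hp, rfl⟩ := hf
      exact joinable_add_smul_relator hp (hP p hp)
    | zero =>
      intro c g
      rw [smul_zero, add_zero]
      exact hconf.equivalence_joinable.refl g
    | add f₁ f₂ _ _ ih₁ ih₂ =>
      intro c g
      rw [smul_add, ← add_assoc]
      exact hconf.equivalence_joinable.trans (ih₂ c _) (ih₁ c g)
    | smul d f _ ih =>
      intro c g
      rw [smul_smul]
      exact ih _ g
  simpa only [one_smul] using smul_mem 1 g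

theorem Confluent.relatorSpan_inf_normalForms_eq_bot (hconf : Confluent b P)
    (hP : IsDecreasing b P) : relatorSpan b P ⊓ normalForms b P = ⊥ := by
  refine (Submodule.eq_bot_iff _).2 fun f hf => ?_
  obtain ⟨hrel, hnf⟩ := Submodule.mem_inf.1 hf
  obtain ⟨h, hfh, hzero⟩ := hconf.joinable_add_of_mem_relatorSpan hP hrel 0
  rw [zero_add] at hfh
  rw [← eq_of_rewrites_of_mem_normalForms hfh hnf,
    eq_of_rewrites_of_mem_normalForms hzero (zero_mem _)]

/-- Triangularity: in a combination of the `b t - r t`, the largest `t` that occurs is not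
cancelled. -/
theorem disjoint_span_sub_span_compl {A : Set W} {r : W → V}
    (hr : ∀ t ∈ A, r t ∈ lowerSpan b t) :
    Disjoint (Submodule.span k ((fun t => b t - r t) '' A)) (Submodule.span k (b '' Aᶜ)) := by
  refine Submodule.disjoint_def.2 fun f hf hfA => ?_
  obtain ⟨c, hc, rfl⟩ := (Finsupp.mem_span_image_iff_linearCombination k).1 hf
  suffices c = 0 by rw [this, map_zero]
  by_contra hc0
  have hne : c.support.Nonempty := Finsupp.support_nonempty_iff.2 hc0
  set t := c.support.max' hne
  have htc : t ∈ c.support := c.support.max'_mem hne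
  have hcoeff : b.repr (Finsupp.linearCombination k (fun t => b t - r t) c) t = c t := by
    rw [Finsupp.linearCombination_apply, Finsupp.sum, map_sum, Finsupp.finsetSum_apply,
      Finset.sum_eq_single_of_mem t htc fun u hu hut => ?_]
    · rw [map_smul, Finsupp.smul_apply, repr_sub_self (hr t (hc htc)), smul_eq_mul, mul_one]
    · have hlt : u < t := lt_of_le_of_ne (c.support.le_max' u hu) hut
      rw [map_smul, Finsupp.smul_apply, repr_sub_of_lt (hr u (hc hu)) hlt, smul_zero]
  exact b.mem_span_image.1 hfA
    (Finsupp.mem_support_iff.2 (hcoeff ▸ Finsupp.mem_support_iff.1 htc)) (hc htc)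

variable [WellFoundedLT W]

theorem IsDecreasing.wellFounded_oneStep (hP : IsDecreasing b P) :
    WellFounded fun g f : V => OneStep b P f g := by
  have hlex : WellFounded (Finsupp.Lex (fun t u : W => u < t) fun c d : k => c = 0 ∧ d ≠ 0) :=
    Finsupp.Lex.wellFounded' (fun _ h => h.2 rfl)
      ⟨fun d => ⟨_, fun _ hc => ⟨_, fun _ hb => absurd hc.1 hb.2⟩⟩⟩ wellFounded_lt
  refine Subrelation.wf (fun {g f} step => ?_) (InvImage.wf b.repr hlex)
  obtain ⟨p, hp, hne, rfl⟩ := oneStep_iff.1 step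
  refine ⟨p.1, fun u hu => ?_, ?_, hne⟩
  · simp [repr_sub_of_lt (hP p hp) hu, -map_sub, map_sub b.repr f]
  · rw [map_sub b.repr f, map_smul, Finsupp.sub_apply, Finsupp.smul_apply,
      repr_sub_self (hP p hp), smul_eq_mul, mul_one, sub_self]

theorem IsDecreasing.terminating (hP : IsDecreasing b P) : Terminating b P := fun ⟨f, hf⟩ =>
  (wellFounded_iff_isEmpty_descending_chain.1 hP.wellFounded_oneStep).false ⟨f, hf⟩

theorem IsDecreasing.exists_rewrites_mem_normalForms (hP : IsDecreasing b P) (f : V) :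
    ∃ g ∈ normalForms b P, Rewrites b P f g := by
  induction f using hP.wellFounded_oneStep.induction with
  | _ f ih =>
  by_cases hf : f ∈ normalForms b P
  · exact ⟨f, hf, .refl⟩
  · rw [mem_normalForms_iff] at hf
    push Not at hf
    obtain ⟨p, hp, hne⟩ := hf
    have step := oneStep_iff.2 ⟨p, hp, hne, rfl⟩
    obtain ⟨g, hg, hr⟩ := ih _ step
    exact ⟨g, hg, .head step hr⟩

/-- Normalize with the rules below `t` only: the result stays below `t`, so it is a normal form of
the whole system. -/
theorem IsDecreasing.relatorSpan_inf_lowerSpan_le (hP : IsDecreasing b P)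
    (h : relatorSpan b P ⊓ normalForms b P = ⊥) (t : W) :
    relatorSpan b P ⊓ lowerSpan b t ≤ relatorSpan b {p ∈ P | p.1 < t} := by
  intro f hf
  obtain ⟨hrel, hlow⟩ := Submodule.mem_inf.1 hf
  have hPt : IsDecreasing b {p ∈ P | p.1 < t} := fun p hp => hP p hp.1
  obtain ⟨g, hg, hfg⟩ := hPt.exists_rewrites_mem_normalForms f
  have hsub : f - g ∈ relatorSpan b {p ∈ P | p.1 < t} := sub_mem_relatorSpan_of_rewrites hfg
  have hglow : g ∈ lowerSpan b t := by
    simpa only [sub_sub_cancel] using sub_mem hlow (hP.relatorSpan_le_lowerSpan t hsub)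
  have hgrel : g ∈ relatorSpan b P := by
    simpa only [sub_sub_cancel] using sub_mem hrel (relatorSpan_mono (Set.sep_subset _ _) hsub)
  have hgnf : g ∈ normalForms b P := mem_normalForms_iff.2 fun p hp =>
    (lt_or_ge p.1 t).elim (fun hpt => mem_normalForms_iff.1 hg p ⟨hp, hpt⟩)
      (repr_eq_zero_of_mem_lowerSpan hglow)
  obtain rfl : g = 0 := (Submodule.mem_bot k).1 (h ▸ Submodule.mem_inf.2 ⟨hgrel, hgnf⟩)
  rwa [sub_zero] at hsub

theorem IsDecreasing.isResolvable (hP : IsDecreasing b P)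
    (h : relatorSpan b P ⊓ normalForms b P = ⊥) : IsResolvable b P := by
  refine fun t v₁ v₂ h₁ h₂ => hP.relatorSpan_inf_lowerSpan_le h t (Submodule.mem_inf.2 ⟨?_, ?_⟩)
  · have hv₁ : b t - v₁ ∈ relatorSpan b P := relator_mem_relatorSpan h₁
    have hv₂ : b t - v₂ ∈ relatorSpan b P := relator_mem_relatorSpan h₂
    simpa only [sub_sub_sub_cancel_left] using sub_mem hv₂ hv₁
  · exact sub_mem (hP (t, v₁) h₁) (hP (t, v₂) h₂)

theorem IsResolvable.relatorSpan_le_span (hres : IsResolvable b P) {r : W → V}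
    (hr : ∀ p ∈ P, (p.1, r p.1) ∈ P) :
    relatorSpan b P ≤ Submodule.span k ((fun t => b t - r t) '' {t | ∃ v, (t, v) ∈ P}) := by
  refine Submodule.span_le.2 ?_
  rintro _ ⟨⟨t, v⟩, hp, rfl⟩
  induction t using WellFoundedLT.induction generalizing v with
  | ind t ih =>
  have hlow : relatorSpan b {p ∈ P | p.1 < t} ≤
      Submodule.span k ((fun t => b t - r t) '' {t | ∃ v, (t, v) ∈ P}) := by
    refine Submodule.span_le.2 ?_
    rintro _ ⟨p, ⟨hpP, hpt⟩, rfl⟩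
    exact ih p.1 hpt p.2 hpP
  change b t - v ∈ _
  rw [← sub_add_sub_cancel (b t) (r t) v]
  exact add_mem (Submodule.subset_span ⟨t, ⟨v, hp⟩, rfl⟩) (hlow (hres t _ _ (hr _ hp) hp))

theorem IsResolvable.relatorSpan_inf_normalForms_eq_bot (hres : IsResolvable b P)
    (hP : IsDecreasing b P) : relatorSpan b P ⊓ normalForms b P = ⊥ := by
  have hrule (t : W) : ∃ v, ∀ v', (t, v') ∈ P → (t, v) ∈ P := by
    by_cases h : ∃ v, (t, v) ∈ P
    · exact ⟨h.choose, fun _ _ => h.choose_spec⟩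
    · exact ⟨0, fun v' hv' => absurd ⟨v', hv'⟩ h⟩
  choose r hr using hrule
  have hcompl : {t | ∀ v, (t, v) ∉ P} = {t | ∃ v, (t, v) ∈ P}ᶜ := by
    ext
    simp
  have hlow : ∀ t ∈ {t | ∃ v, (t, v) ∈ P}, r t ∈ lowerSpan b t := by
    rintro t ⟨v, hv⟩
    exact hP (t, r t) (hr t v hv)
  rw [normalForms, hcompl, ← disjoint_iff]
  exact (disjoint_span_sub_span_compl hlow).mono_left
    (hres.relatorSpan_le_span fun p hp => hr p.1 p.2 hp)

theorem IsDecreasing.tfae (hP : IsDecreasing b P) :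
    List.TFAE
      [Convergent b P,
       Confluent b P,
       relatorSpan b P ⊓ normalForms b P = ⊥,
       IsCompl (relatorSpan b P) (normalForms b P),
       IsResolvable b P] := by
  have hnf := hP.exists_rewrites_mem_normalForms
  tfae_have 1 → 2 := And.right
  tfae_have 2 → 3 := fun h => h.relatorSpan_inf_normalForms_eq_bot hP
  tfae_have 3 → 1 := fun h =>
    ⟨hP.terminating, confluent_of_relatorSpan_inf_normalForms_eq_bot hnf h⟩
  tfae_have 3 → 4 := fun h => IsCompl.of_eq h (relatorSpan_sup_normalForms_eq_top hnf)
  tfae_have 4 → 3 := IsCompl.inf_eq_bot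
  tfae_have 3 → 5 := hP.isResolvable
  tfae_have 5 → 3 := fun h => h.relatorSpan_inf_normalForms_eq_bot hP
  tfae_finish

end TermRewriting

namespace BracketedWord

variable {X : Type u}

@[simp] theorem nil_mul (a : BracketedWord X) : nil * a = a := rfl

@[simp] theorem var_mul (x : X) (a b : BracketedWord X) : var x a * b = var x (a * b) := rfl

@[simp] theorem br_mul (a b c : BracketedWord X) : br a b * c = br a (b * c) := rfl

theorem breadth_mul (a b : BracketedWord X) : (a * b).breadth = a.breadth + b.breadth := by
  induction a with
  | nil => simp only [nil_mul, breadth, zero_add]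
  | var x r ih => rw [var_mul, breadth, breadth, ih, add_right_comm]
  | br a r _ ih => rw [br_mul, breadth, breadth, ih, add_right_comm]

theorem breadth_pos {a : BracketedWord X} (h : a ≠ 1) : 0 < a.breadth := by
  cases a with
  | nil => exact absurd rfl h
  | var x r => exact Nat.succ_pos _
  | br a r => exact Nat.succ_pos _

theorem mul_eq_mul_cases {a b u v : BracketedWord X} (h : a * b = u * v) :
    (∃ c, u = a * c ∧ b = c * v) ∨ ∃ c, a = u * c ∧ v = c * b := by
  induction a generalizing u with
  | nil => exact .inl ⟨u, rfl, h⟩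
  | var x r ih =>
    cases u with
    | nil => exact .inr ⟨var x r, rfl, h.symm⟩
    | var y u =>
      obtain ⟨rfl, h'⟩ := var.inj h
      exact (ih h').imp (fun ⟨c, hu, hb⟩ => ⟨c, congrArg _ hu, hb⟩)
        fun ⟨c, ha, hv⟩ => ⟨c, congrArg _ ha, hv⟩
    | br y u => nomatch h
  | br a r _ ih =>
    cases u with
    | nil => exact .inr ⟨br a r, rfl, h.symm⟩
    | var y u => nomatch h
    | br y u =>
      obtain ⟨rfl, h'⟩ := br.inj h
      exact (ih h').imp (fun ⟨c, hu, hb⟩ => ⟨c, congrArg _ hu, hb⟩)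
        fun ⟨c, ha, hv⟩ => ⟨c, congrArg _ ha, hv⟩

/-- The maps `b ↦ q|_b` with `q` a `⋆`-bracketed word, generated along the path from the root of
`q` to `⋆`.  That these are all such maps, and no others, is `isContext_iff`. -/
inductive IsContext : (BracketedWord X → BracketedWord X) → Prop
  | head (r : BracketedWord X) : IsContext fun b => b * r
  | var (x : X) {φ : BracketedWord X → BracketedWord X} (hφ : IsContext φ) :
      IsContext fun b => var x (φ b)
  | brInner (r : BracketedWord X) {φ : BracketedWord X → BracketedWord X} (hφ : IsContext φ) :
      IsContext fun b => br (φ b) r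
  | brOuter (a : BracketedWord X) {φ : BracketedWord X → BracketedWord X} (hφ : IsContext φ) :
      IsContext fun b => br a (φ b)

section IsContext

variable {φ ψ : BracketedWord X → BracketedWord X}

theorem isContext_id : IsContext fun b : BracketedWord X => b := by
  simpa only [mul_one] using IsContext.head (1 : BracketedWord X)

theorem IsContext.mul_right (hφ : IsContext φ) (r : BracketedWord X) :
    IsContext fun b => φ b * r := by
  induction hφ with
  | head s => simpa only [mul_assoc] using IsContext.head (s * r)
  | var x _ ih => exact .var x ih
  | brInner s hφ _ => exact .brInner (s * r) hφ
  | brOuter a _ ih => exact .brOuter a ih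

theorem IsContext.mul_left (hφ : IsContext φ) (a : BracketedWord X) :
    IsContext fun b => a * φ b := by
  induction a with
  | nil => exact hφ
  | var x _ ih => exact .var x ih
  | br a _ _ ih => exact .brOuter a ih

theorem IsContext.comp (hφ : IsContext φ) (hψ : IsContext ψ) : IsContext fun b => φ (ψ b) := by
  induction hφ with
  | head r => exact hψ.mul_right r
  | var x _ ih => exact .var x ih
  | brInner r _ ih => exact .brInner r ih
  | brOuter a _ ih => exact .brOuter a ih

theorem exists_substStar_eq_of_starCount_eq_zero {p : BracketedWord (Option X)}
    (hp : p.starCount = 0) : ∃ r : BracketedWord X, ∀ b, substStar b p = r := by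
  induction p with
  | nil => exact ⟨1, fun _ => rfl⟩
  | var x p ih =>
    cases x with
    | none => exact absurd hp (Nat.succ_ne_zero _)
    | some x =>
      obtain ⟨r, hr⟩ := ih hp
      exact ⟨var x r, fun b => congrArg _ (hr b)⟩
  | br p p' ih ih' =>
    obtain ⟨hp, hp'⟩ := Nat.add_eq_zero_iff.1 hp
    obtain ⟨a, ha⟩ := ih hp
    obtain ⟨r, hr⟩ := ih' hp'
    exact ⟨br a r, fun b => congrArg₂ _ (ha b) (hr b)⟩

theorem exists_starCount_eq_zero_substStar_eq (r : BracketedWord X) :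
    ∃ p : BracketedWord (Option X), p.starCount = 0 ∧ ∀ b, substStar b p = r := by
  induction r with
  | nil => exact ⟨nil, rfl, fun _ => rfl⟩
  | var x r ih =>
    obtain ⟨p, hp, hr⟩ := ih
    exact ⟨var (some x) p, hp, fun b => congrArg _ (hr b)⟩
  | br a r ih ih' =>
    obtain ⟨p, hp, ha⟩ := ih
    obtain ⟨p', hp', hr⟩ := ih'
    exact ⟨br p p', by rw [starCount, hp, hp'], fun b => congrArg₂ _ (ha b) (hr b)⟩

theorem isContext_substStar {p : BracketedWord (Option X)} (hp : p.starCount = 1) :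
    IsContext fun b => substStar b p := by
  induction p with
  | nil => exact absurd hp Nat.zero_ne_one
  | var x p ih =>
    cases x with
    | none =>
      obtain ⟨r, hr⟩ := exists_substStar_eq_of_starCount_eq_zero (Nat.succ.inj hp)
      simpa only [substStar, hr] using IsContext.head r
    | some x => exact .var x (ih hp)
  | br p p' ih ih' =>
    rcases Nat.add_eq_one_iff.1 hp with ⟨hp, hp'⟩ | ⟨hp, hp'⟩
    · obtain ⟨a, ha⟩ := exists_substStar_eq_of_starCount_eq_zero hp
      simpa only [substStar, ha] using IsContext.brOuter a (ih' hp')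
    · obtain ⟨r, hr⟩ := exists_substStar_eq_of_starCount_eq_zero hp'
      simpa only [substStar, hr] using IsContext.brInner r (ih hp)

theorem IsContext.exists_plug_eq (hφ : IsContext φ) : ∃ q : StarWord X, q.plug = φ := by
  induction hφ with
  | head r =>
    obtain ⟨p, hp, hr⟩ := exists_starCount_eq_zero_substStar_eq r
    exact ⟨⟨.var none p, congrArg (· + 1) hp⟩, funext fun b => congrArg (b * ·) (hr b)⟩
  | var x _ ih =>
    obtain ⟨q, rfl⟩ := ih
    exact ⟨⟨.var (some x) q.1, q.2⟩, rfl⟩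
  | brInner r _ ih =>
    obtain ⟨q, rfl⟩ := ih
    obtain ⟨p, hp, hr⟩ := exists_starCount_eq_zero_substStar_eq r
    exact ⟨⟨br q.1 p, by rw [starCount, q.2, hp]⟩, funext fun b => congrArg (br _) (hr b)⟩
  | brOuter a _ ih =>
    obtain ⟨q, rfl⟩ := ih
    obtain ⟨p, hp, ha⟩ := exists_starCount_eq_zero_substStar_eq a
    exact ⟨⟨br p q.1, by rw [starCount, q.2, hp]⟩, funext fun b => congrArg (br · _) (ha b)⟩

theorem isContext_iff : IsContext φ ↔ ∃ q : StarWord X, q.plug = φ :=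
  ⟨IsContext.exists_plug_eq, fun ⟨q, hq⟩ => hq ▸ isContext_substStar q.2⟩

theorem isContext_plug (q : StarWord X) : IsContext q.plug :=
  isContext_iff.2 ⟨q, rfl⟩

theorem IsContext.eq_mul_cases (hφ : IsContext φ) {b u v : BracketedWord X} (h : φ b = u * v) :
    (∃ p, IsContext p ∧ u = p b ∧ φ = fun c => p c * v) ∨
    (∃ p, IsContext p ∧ v = p b ∧ φ = fun c => u * p c) ∨
    ∃ n m b₁ b₂, b = b₁ * b₂ ∧ u = n * b₁ ∧ v = b₂ * m ∧ φ = fun c => n * (c * m) := by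
  induction hφ generalizing u with
  | head r =>
    rcases mul_eq_mul_cases h with ⟨c, rfl, rfl⟩ | ⟨c, rfl, rfl⟩
    · exact .inl ⟨_, .head c, rfl, by simp only [mul_assoc]⟩
    · exact .inr (.inr ⟨1, r, u, c, rfl, rfl, rfl, rfl⟩)
  | var x hφ ih =>
    cases u with
    | nil => exact .inr (.inl ⟨_, .var x hφ, h.symm, rfl⟩)
    | var y u =>
      obtain ⟨rfl, h'⟩ := var.inj h
      rcases ih h' with ⟨p, hp, rfl, rfl⟩ | ⟨p, hp, rfl, rfl⟩ | ⟨n, m, b₁, b₂, rfl, rfl, rfl, rfl⟩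
      · exact .inl ⟨_, .var x hp, rfl, rfl⟩
      · exact .inr (.inl ⟨p, hp, rfl, rfl⟩)
      · exact .inr (.inr ⟨.var x n, m, b₁, b₂, rfl, rfl, rfl, rfl⟩)
    | br a u => nomatch h
  | brInner r hφ _ =>
    cases u with
    | nil => exact .inr (.inl ⟨_, .brInner r hφ, h.symm, rfl⟩)
    | var y u => nomatch h
    | br a u =>
      obtain ⟨rfl, rfl⟩ := br.inj h
      exact .inl ⟨_, .brInner u hφ, rfl, rfl⟩
  | brOuter a hφ ih =>
    cases u with
    | nil => exact .inr (.inl ⟨_, .brOuter a hφ, h.symm, rfl⟩)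
    | var y u => nomatch h
    | br a' u =>
      obtain ⟨rfl, h'⟩ := br.inj h
      rcases ih h' with ⟨p, hp, rfl, rfl⟩ | ⟨p, hp, rfl, rfl⟩ | ⟨n, m, b₁, b₂, rfl, rfl, rfl, rfl⟩
      · exact .inl ⟨_, .brOuter a hp, rfl, rfl⟩
      · exact .inr (.inl ⟨p, hp, rfl, rfl⟩)
      · exact .inr (.inr ⟨.br a n, m, b₁, b₂, rfl, rfl, rfl, rfl⟩)

end IsContext

/-- The relative locations of two subwords `u` and `v` of one bracketed word, whose positions are
recorded by contexts `φ` and `ψ` with `φ u = ψ v`: the subwords are disjoint, one is contained in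
the other, or they overlap; each pattern may sit inside a larger word. -/
inductive RelativeLocation : BracketedWord X → BracketedWord X →
    (BracketedWord X → BracketedWord X) → (BracketedWord X → BracketedWord X) → Prop
  | separated {p q : BracketedWord X → BracketedWord X} (hp : IsContext p) (hq : IsContext q)
      (u v : BracketedWord X) :
      RelativeLocation u v (fun b => p b * q v) fun b => p u * q b
  | nested {p : BracketedWord X → BracketedWord X} (hp : IsContext p) (v : BracketedWord X) :
      RelativeLocation (p v) v (fun b => b) p
  | intersecting {n c m : BracketedWord X} (hn : n ≠ 1) (hc : c ≠ 1) (hm : m ≠ 1) :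
      RelativeLocation (n * c) (c * m) (fun b => b * m) fun b => n * b
  | symm {u v : BracketedWord X} {φ ψ : BracketedWord X → BracketedWord X}
      (h : RelativeLocation u v φ ψ) : RelativeLocation v u ψ φ
  | comp {χ : BracketedWord X → BracketedWord X} (hχ : IsContext χ) {u v : BracketedWord X}
      {φ ψ : BracketedWord X → BracketedWord X} (h : RelativeLocation u v φ ψ) :
      RelativeLocation u v (fun b => χ (φ b)) fun b => χ (ψ b)

section RelativeLocation

variable {u v : BracketedWord X} {φ ψ : BracketedWord X → BracketedWord X}

theorem RelativeLocation.apply_eq (h : RelativeLocation u v φ ψ) : φ u = ψ v := by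
  induction h with
  | separated | nested => rfl
  | intersecting => exact mul_assoc _ _ _
  | symm _ ih => exact ih.symm
  | comp _ _ ih => exact congrArg _ ih

theorem relativeLocation_of_eq_mul (hψ : IsContext ψ) {r : BracketedWord X} (h : ψ v = u * r) :
    RelativeLocation u v (fun b => b * r) ψ := by
  rcases hψ.eq_mul_cases h with ⟨p, hp, rfl, rfl⟩ | ⟨p, hp, rfl, rfl⟩ |
    ⟨n, m, b₁, b₂, rfl, rfl, rfl, rfl⟩
  · exact .comp (.head r) (.nested hp v)
  · exact .separated isContext_id hp u v
  · rcases eq_or_ne b₁ 1 with rfl | hb₁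
    · simpa only [mul_one, one_mul] using RelativeLocation.separated isContext_id (.head m) n b₂
    rcases eq_or_ne b₂ 1 with rfl | hb₂
    · simpa only [mul_one, one_mul, mul_assoc] using
        RelativeLocation.comp (.head m) (.nested (isContext_id.mul_left n) b₁)
    rcases eq_or_ne n 1 with rfl | hn
    · simpa only [one_mul, mul_assoc] using
        RelativeLocation.comp (.head m) (.symm (.nested (.head b₂) b₁))
    · simpa only [mul_assoc] using
        RelativeLocation.comp (.head m) (.intersecting hn hb₁ hb₂)

theorem relativeLocation_of_apply_eq (hφ : IsContext φ) (hψ : IsContext ψ) (h : φ u = ψ v) :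
    RelativeLocation u v φ ψ := by
  induction hφ generalizing ψ with
  | head r => exact relativeLocation_of_eq_mul hψ h.symm
  | var x hφ ih =>
    cases hψ with
    | head r => exact .symm (relativeLocation_of_eq_mul (.var x hφ) h)
    | var y hψ =>
      obtain ⟨rfl, h'⟩ := var.inj h
      exact .comp (.var x isContext_id) (ih hψ h')
    | brInner | brOuter => nomatch h
  | brInner r hφ ih =>
    cases hψ with
    | head s => exact .symm (relativeLocation_of_eq_mul (.brInner r hφ) h)
    | var => nomatch h
    | brInner s hψ =>
      obtain ⟨h', rfl⟩ := br.inj h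
      exact .comp (.brInner r isContext_id) (ih hψ h')
    | brOuter a hψ =>
      obtain ⟨rfl, rfl⟩ := br.inj h
      exact .separated (.brInner 1 hφ) hψ u v
  | brOuter a hφ ih =>
    cases hψ with
    | head s => exact .symm (relativeLocation_of_eq_mul (.brOuter a hφ) h)
    | var => nomatch h
    | brInner r hψ =>
      obtain ⟨rfl, rfl⟩ := br.inj h
      exact .symm (.separated (.brInner 1 hψ) hφ v u)
    | brOuter a hψ =>
      obtain ⟨rfl, h'⟩ := br.inj h
      exact .comp (.brOuter a isContext_id) (ih hψ h')

end RelativeLocation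

end BracketedWord

namespace BracketedPoly

open BracketedWord TermRewriting

variable {k : Type v} {X : Type u} [CommRing k] {φ ψ : BracketedWord X → BracketedWord X}
  {S : Set (BracketedPoly k X)}

/-- The linear extension to `k𝔐(X)` of a map `φ` on bracketed words; it subsumes `plug` and
`bracket`. -/
noncomputable def linearExtend (k : Type v) {X : Type u} [CommRing k]
    (φ : BracketedWord X → BracketedWord X) : BracketedPoly k X →ₗ[k] BracketedPoly k X :=
  MonoidAlgebra.mapDomainLinearMap k k φ

theorem plug_eq_linearExtend (q : StarWord X) (f : BracketedPoly k X) :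
    plug q f = linearExtend k q.plug f := rfl

theorem bracket_eq_linearExtend (f : BracketedPoly k X) :
    bracket f = linearExtend k BracketedWord.bracket f := rfl

theorem linearExtend_mono (φ : BracketedWord X → BracketedWord X) (a : BracketedWord X) :
    linearExtend k φ (mono k a) = mono k (φ a) :=
  MonoidAlgebra.mapDomainLinearMap_single φ 1 a

theorem linearExtend_linearExtend (φ ψ : BracketedWord X → BracketedWord X)
    (f : BracketedPoly k X) :
    linearExtend k φ (linearExtend k ψ f) = linearExtend k (fun b => φ (ψ b)) f :=
  (LinearMap.congr_fun (MonoidAlgebra.mapDomainLinearMap_comp (R := k) (S := k) ψ φ) f).symm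

theorem linearExtend_id (f : BracketedPoly k X) : linearExtend k (fun b => b) f = f := by
  induction f using MonoidAlgebra.induction_linear with
  | zero => exact map_zero _
  | add f g hf hg => rw [map_add, hf, hg]
  | single b c => exact MonoidAlgebra.mapDomainLinearMap_single _ c b

theorem mono_mul (a : BracketedWord X) (f : BracketedPoly k X) :
    mono k a * f = linearExtend k (fun b => a * b) f := by
  induction f using MonoidAlgebra.induction_linear with
  | zero => rw [mul_zero, map_zero]
  | add f g hf hg => rw [mul_add, map_add, hf, hg]
  | single b c => simp [mono, linearExtend]

theorem mul_mono (f : BracketedPoly k X) (a : BracketedWord X) :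
    f * mono k a = linearExtend k (fun b => b * a) f := by
  induction f using MonoidAlgebra.induction_linear with
  | zero => rw [zero_mul, map_zero]
  | add f g hf hg => rw [add_mul, map_add, hf, hg]
  | single b c => simp [mono, linearExtend]

theorem mono_mul_linearExtend (a : BracketedWord X) (φ : BracketedWord X → BracketedWord X)
    (f : BracketedPoly k X) :
    mono k a * linearExtend k φ f = linearExtend k (fun b => a * φ b) f := by
  rw [mono_mul, linearExtend_linearExtend]

theorem linearExtend_mul_mono (φ : BracketedWord X → BracketedWord X) (f : BracketedPoly k X)
    (a : BracketedWord X) :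
    linearExtend k φ f * mono k a = linearExtend k (fun b => φ b * a) f := by
  rw [mul_mono, linearExtend_linearExtend]

theorem mem_span_mono (f : BracketedPoly k X) :
    f ∈ Submodule.span k (Set.range (mono k : BracketedWord X → BracketedPoly k X)) :=
  (MonoidAlgebra.basis (BracketedWord X) k).mem_span f

theorem IsOperatedIdeal.linearExtend_mem {I : Submodule k (BracketedPoly k X)}
    (hI : IsOperatedIdeal I) (hφ : IsContext φ) {f : BracketedPoly k X} (hf : f ∈ I) :
    linearExtend k φ f ∈ I := by
  induction hφ with
  | head r =>
    rw [← mul_mono]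
    exact hI.mul_mem_right _ _ hf
  | @var x φ _ ih =>
    have h := hI.mul_mem_left (mono k (.var x 1)) _ ih
    rwa [mono_mul_linearExtend] at h
  | @brInner r φ _ ih =>
    have h := hI.mul_mem_right (mono k r) _ (hI.bracket_mem _ ih)
    rwa [bracket_eq_linearExtend, linearExtend_linearExtend, linearExtend_mul_mono] at h
  | @brOuter a φ _ ih =>
    have h := hI.mul_mem_left (mono k (.br a 1)) _ ih
    rwa [mono_mul_linearExtend] at h

theorem isOperatedIdeal_of_linearExtend_mem {I : Submodule k (BracketedPoly k X)}
    (hI : ∀ φ, IsContext φ → ∀ f ∈ I, linearExtend k φ f ∈ I) : IsOperatedIdeal I where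
  mul_mem_left a f hf := by
    refine (Submodule.map_span_le (LinearMap.mulRight k f) _ I).2 ?_
      (Submodule.mem_map_of_mem (mem_span_mono a))
    rintro _ ⟨b, rfl⟩
    rw [LinearMap.mulRight_apply, mono_mul]
    exact hI _ (isContext_id.mul_left b) f hf
  mul_mem_right a f hf := by
    refine (Submodule.map_span_le (LinearMap.mulLeft k f) _ I).2 ?_
      (Submodule.mem_map_of_mem (mem_span_mono a))
    rintro _ ⟨b, rfl⟩
    rw [LinearMap.mulLeft_apply, mul_mono]
    exact hI _ (.head b) f hf
  bracket_mem := hI _ (.brInner 1 isContext_id)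

theorem operatedIdeal_eq_span (S : Set (BracketedPoly k X)) :
    operatedIdeal S =
      Submodule.span k {g | ∃ s ∈ S, ∃ φ, IsContext φ ∧ g = linearExtend k φ s} := by
  have ideal := (isLeast_operatedIdeal S).1
  refine le_antisymm ((isLeast_operatedIdeal S).2 ⟨isOperatedIdeal_of_linearExtend_mem ?_, ?_⟩)
    (Submodule.span_le.2 ?_)
  · refine fun φ hφ f hf =>
      (Submodule.map_span_le (linearExtend k φ) _ _).2 ?_ (Submodule.mem_map_of_mem hf)
    rintro _ ⟨s, hs, ψ, hψ, rfl⟩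
    rw [linearExtend_linearExtend]
    exact Submodule.subset_span ⟨s, hs, _, hφ.comp hψ, rfl⟩
  · exact fun s hs => Submodule.subset_span ⟨s, hs, _, isContext_id, (linearExtend_id s).symm⟩
  · rintro _ ⟨s, hs, φ, hφ, rfl⟩
    exact ideal.1.linearExtend_mem hφ (ideal.2 hs)

variable [LinearOrder (BracketedWord X)]

theorem mem_rewritingSystem_iff {p : BracketedWord X × BracketedPoly k X} :
    p ∈ rewritingSystem S ↔ ∃ s ∈ S, ∃ φ, IsContext φ ∧
      p = (φ (leadingMonomial s), linearExtend k φ (remainder s)) := by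
  simp only [rewritingSystem, isContext_iff, plug_eq_linearExtend, Set.mem_ofPred_eq,
    ↓existsAndEq, true_and]

theorem isTrivialMod_iff_mem_span {a : BracketedWord X} {f : BracketedPoly k X} :
    IsTrivialMod S a f ↔ f ∈ Submodule.span k
      {g | ∃ s ∈ S, ∃ φ, IsContext φ ∧ φ (leadingMonomial s) < a ∧ g = linearExtend k φ s} := by
  simp only [IsTrivialMod, isContext_iff, plug_eq_linearExtend, ↓existsAndEq, true_and]

theorem normalForms_rewritingSystem (S : Set (BracketedPoly k X)) :
    normalForms (MonoidAlgebra.basis (BracketedWord X) k) (rewritingSystem S) = irrSpan S := by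
  have irr_eq : irr S = {t | ∀ v, (t, v) ∉ rewritingSystem S} := by
    refine Set.ext fun t => ⟨?_, ?_⟩
    · rintro ht v ⟨s, hs, q, hp⟩
      exact ht ⟨s, hs, q, (congrArg Prod.fst hp).symm⟩
    · rintro ht ⟨s, hs, q, rfl⟩
      exact ht _ ⟨s, hs, q, rfl⟩
  rw [irrSpan, irr_eq]
  rfl

theorem linearExtend_add_remainder {s : BracketedPoly k X} (hs : leadingCoeff s = 1)
    (φ : BracketedWord X → BracketedWord X) :
    linearExtend k φ s + linearExtend k φ (remainder s) = mono k (φ (leadingMonomial s)) := by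
  rw [← map_add, remainder, hs, one_smul, add_sub_cancel, linearExtend_mono]

theorem relatorSpan_sep_rewritingSystem (hS : ∀ s ∈ S, leadingCoeff s = 1)
    (A : Set (BracketedWord X)) :
    relatorSpan (MonoidAlgebra.basis (BracketedWord X) k) {p ∈ rewritingSystem S | p.1 ∈ A} =
      Submodule.span k
        {g | ∃ s ∈ S, ∃ φ, IsContext φ ∧ φ (leadingMonomial s) ∈ A ∧ g = linearExtend k φ s} := by
  have relator {s : BracketedPoly k X} (hs : s ∈ S) (φ : BracketedWord X → BracketedWord X) :
      mono k (φ (leadingMonomial s)) - linearExtend k φ (remainder s) = linearExtend k φ s :=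
    sub_eq_of_eq_add (linearExtend_add_remainder (hS s hs) φ).symm
  refine congrArg (Submodule.span k) (Set.ext fun g => ⟨?_, ?_⟩)
  · rintro ⟨p, ⟨hp, hpA⟩, rfl⟩
    obtain ⟨s, hs, φ, hφ, rfl⟩ := mem_rewritingSystem_iff.1 hp
    exact ⟨s, hs, φ, hφ, hpA, relator hs φ⟩
  · rintro ⟨s, hs, φ, hφ, hA, rfl⟩
    exact ⟨_, ⟨mem_rewritingSystem_iff.2 ⟨s, hs, φ, hφ, rfl⟩, hA⟩, relator hs φ⟩

theorem relatorSpan_rewritingSystem (hS : ∀ s ∈ S, leadingCoeff s = 1) :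
    relatorSpan (MonoidAlgebra.basis (BracketedWord X) k) (rewritingSystem S) =
      operatedIdeal S := by
  simpa only [Set.mem_univ, and_true, true_and, Set.ofPred_mem_eq, ← operatedIdeal_eq_span] using
    relatorSpan_sep_rewritingSystem hS Set.univ

theorem isTrivialMod_iff_mem_relatorSpan (hS : ∀ s ∈ S, leadingCoeff s = 1)
    {a : BracketedWord X} {f : BracketedPoly k X} :
    IsTrivialMod S a f ↔ f ∈ relatorSpan (MonoidAlgebra.basis (BracketedWord X) k)
      {p ∈ rewritingSystem S | p.1 < a} := by
  rw [isTrivialMod_iff_mem_span]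
  exact (relatorSpan_sep_rewritingSystem hS (Set.Iio a)).symm ▸ Iff.rfl

theorem le_leadingMonomial {s : BracketedPoly k X} {a : BracketedWord X} (h : s.coeff a ≠ 0) :
    a ≤ leadingMonomial s := by
  have ha : a ∈ s.coeff.support := Finsupp.mem_support_iff.2 h
  rw [leadingMonomial, dif_pos ⟨a, ha⟩]
  exact Finset.le_max' _ _ ha

theorem remainder_mem_lowerSpan (s : BracketedPoly k X) :
    remainder s ∈ lowerSpan (MonoidAlgebra.basis (BracketedWord X) k) (leadingMonomial s) := by
  classical
  have coeff_remainder (t : BracketedWord X) :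
      (MonoidAlgebra.basis (BracketedWord X) k).repr (remainder s) t =
        (if leadingMonomial s = t then leadingCoeff s else 0) - s.coeff t := by
    change (remainder s).coeff t = _
    simp [remainder, mono, Finsupp.single_apply]
  refine mem_lowerSpan_iff.2 fun t ht => ?_
  rw [coeff_remainder] at ht
  rcases eq_or_ne (leadingMonomial s) t with rfl | hne
  · exact absurd (by rw [if_pos rfl, leadingCoeff, sub_self]) ht
  · rw [if_neg hne, zero_sub, neg_ne_zero] at ht
    exact lt_of_le_of_ne (le_leadingMonomial ht) hne.symm

theorem linearExtend_mem_lowerSpan (hφ : StrictMono φ) {a : BracketedWord X}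
    {f : BracketedPoly k X} (hf : f ∈ lowerSpan (MonoidAlgebra.basis (BracketedWord X) k) a) :
    linearExtend k φ f ∈ lowerSpan (MonoidAlgebra.basis (BracketedWord X) k) (φ a) := by
  refine (Submodule.map_span_le (linearExtend k φ) _ _).2 ?_ (Submodule.mem_map_of_mem hf)
  rintro _ ⟨b, hb, rfl⟩
  exact Submodule.subset_span ⟨φ b, hφ hb, (linearExtend_mono φ b).symm⟩

theorem _root_.IsMonomialOrder.strictMono (hle : IsMonomialOrder X) (hφ : IsContext φ) :
    StrictMono φ := by
  obtain ⟨q, rfl⟩ := hφ.exists_plug_eq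
  exact fun a b => hle.plug_lt_plug a b q

theorem isDecreasing_rewritingSystem (hle : IsMonomialOrder X) (S : Set (BracketedPoly k X)) :
    IsDecreasing (MonoidAlgebra.basis (BracketedWord X) k) (rewritingSystem S) := by
  intro p hp
  obtain ⟨s, -, φ, hφ, rfl⟩ := mem_rewritingSystem_iff.1 hp
  exact linearExtend_mem_lowerSpan (hle.strictMono hφ) (remainder_mem_lowerSpan s)

theorem isTrivialMod_linearExtend {a : BracketedWord X} {s : BracketedPoly k X} (hs : s ∈ S)
    (hφ : IsContext φ) (h : φ (leadingMonomial s) < a) : IsTrivialMod S a (linearExtend k φ s) :=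
  isTrivialMod_iff_mem_span.2 (Submodule.subset_span ⟨s, hs, φ, hφ, h, rfl⟩)

theorem IsTrivialMod.neg {a : BracketedWord X} {f : BracketedPoly k X} (hf : IsTrivialMod S a f) :
    IsTrivialMod S a (-f) :=
  Submodule.neg_mem _ hf

theorem IsTrivialMod.linearExtend (hle : IsMonomialOrder X) {a : BracketedWord X}
    {f : BracketedPoly k X} (hf : IsTrivialMod S a f) (hφ : IsContext φ) :
    IsTrivialMod S (φ a) (linearExtend k φ f) := by
  refine (Submodule.map_span_le (BracketedPoly.linearExtend k φ) _ _).2 ?_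
    (Submodule.mem_map_of_mem (isTrivialMod_iff_mem_span.1 hf))
  rintro _ ⟨s, hs, ψ, hψ, hlt, rfl⟩
  rw [linearExtend_linearExtend]
  exact isTrivialMod_linearExtend hs (hφ.comp hψ) (hle.strictMono hφ hlt)

theorem isTrivialMod_mul_linearExtend (hle : IsMonomialOrder X) {a : BracketedWord X}
    {x : BracketedPoly k X} (hx : x ∈ lowerSpan (MonoidAlgebra.basis (BracketedWord X) k) a)
    {s : BracketedPoly k X} (hs : s ∈ S) (hφ : IsContext φ) :
    IsTrivialMod S (a * φ (leadingMonomial s)) (x * linearExtend k φ s) := by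
  refine (Submodule.map_span_le (LinearMap.mulRight k (linearExtend k φ s)) _ _).2 ?_
    (Submodule.mem_map_of_mem hx)
  rintro _ ⟨c, hc, rfl⟩
  change IsTrivialMod S _ (mono k c * linearExtend k φ s)
  rw [mono_mul_linearExtend]
  exact isTrivialMod_linearExtend hs (hφ.mul_left c) (hle.strictMono (.head _) hc)

theorem isTrivialMod_linearExtend_mul (hle : IsMonomialOrder X) {a : BracketedWord X}
    {x : BracketedPoly k X} (hx : x ∈ lowerSpan (MonoidAlgebra.basis (BracketedWord X) k) a)
    {s : BracketedPoly k X} (hs : s ∈ S) (hφ : IsContext φ) :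
    IsTrivialMod S (φ (leadingMonomial s) * a) (linearExtend k φ s * x) := by
  refine (Submodule.map_span_le (LinearMap.mulLeft k (linearExtend k φ s)) _ _).2 ?_
    (Submodule.mem_map_of_mem hx)
  rintro _ ⟨c, hc, rfl⟩
  change IsTrivialMod S _ (linearExtend k φ s * mono k c)
  rw [linearExtend_mul_mono]
  exact isTrivialMod_linearExtend hs (hφ.mul_right c)
    (hle.strictMono (isContext_id.mul_left _) hc)

theorem isTrivialMod_of_separated (hle : IsMonomialOrder X) {f g : BracketedPoly k X}
    (hf : f ∈ S) (hg : g ∈ S) (hfc : leadingCoeff f = 1) (hgc : leadingCoeff g = 1)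
    (hφ : IsContext φ) (hψ : IsContext ψ) :
    IsTrivialMod S (φ (leadingMonomial f) * ψ (leadingMonomial g))
      (linearExtend k (fun b => φ b * ψ (leadingMonomial g)) f -
        linearExtend k (fun b => φ (leadingMonomial f) * ψ b) g) := by
  have lower {χ : BracketedWord X → BracketedWord X} (hχ : IsContext χ) (s : BracketedPoly k X) :=
    linearExtend_mem_lowerSpan (hle.strictMono hχ) (remainder_mem_lowerSpan s)
  rw [← linearExtend_mul_mono, ← mono_mul_linearExtend, ← linearExtend_add_remainder hfc,
    ← linearExtend_add_remainder hgc, mul_add, add_mul, add_sub_add_left_eq_sub]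
  exact Submodule.sub_mem _ (isTrivialMod_linearExtend_mul hle (lower hψ g) hf hφ)
    (isTrivialMod_mul_linearExtend hle (lower hφ f) hg hψ)

theorem IsGroebnerShirshov.isTrivialMod_of_nested (hGS : IsGroebnerShirshov S)
    {f g : BracketedPoly k X} (hf : f ∈ S) (hg : g ∈ S) (hφ : IsContext φ)
    (h : leadingMonomial f = φ (leadingMonomial g)) :
    IsTrivialMod S (leadingMonomial f) (f - linearExtend k φ g) := by
  obtain ⟨q, rfl⟩ := hφ.exists_plug_eq
  exact hGS.including f hf g hg _ q rfl h

theorem IsGroebnerShirshov.isTrivialMod_of_intersecting (hGS : IsGroebnerShirshov S)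
    {f g : BracketedPoly k X} (hf : f ∈ S) (hg : g ∈ S) {n c m : BracketedWord X}
    (hfl : leadingMonomial f = n * c) (hgl : leadingMonomial g = c * m)
    (hn : n ≠ 1) (hc : c ≠ 1) (hm : m ≠ 1) :
    IsTrivialMod S (leadingMonomial f * m) (f * mono k m - mono k n * g) := by
  have hn' := breadth_pos hn
  have hc' := breadth_pos hc
  have hm' := breadth_pos hm
  refine hGS.intersection f hf g hg _ m n rfl (by rw [hfl, hgl, mul_assoc]) ?_ ?_ <;>
    simp only [hfl, hgl, breadth_mul] <;> omega

theorem IsGroebnerShirshov.isTrivialMod_of_relativeLocation (hle : IsMonomialOrder X)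
    (hGS : IsGroebnerShirshov S) (hS : ∀ s ∈ S, leadingCoeff s = 1) {u v : BracketedWord X}
    (h : RelativeLocation u v φ ψ) {f g : BracketedPoly k X} (hf : f ∈ S) (hg : g ∈ S)
    (hfu : leadingMonomial f = u) (hgv : leadingMonomial g = v) :
    IsTrivialMod S (φ u) (linearExtend k φ f - linearExtend k ψ g) := by
  induction h generalizing f g with
  | separated hp hq u v =>
    subst hfu hgv
    exact isTrivialMod_of_separated hle hf hg (hS f hf) (hS g hg) hp hq
  | nested hp v =>
    subst hgv
    rw [linearExtend_id, ← hfu]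
    exact hGS.isTrivialMod_of_nested hf hg hp hfu
  | intersecting hn hc hm =>
    rw [← mul_mono, ← mono_mul, ← hfu]
    exact hGS.isTrivialMod_of_intersecting hf hg hfu hgv hn hc hm
  | symm h ih =>
    rw [← h.apply_eq, ← neg_sub]
    exact (ih hg hf hgv hfu).neg
  | comp hχ _ ih =>
    simpa only [map_sub, linearExtend_linearExtend] using (ih hf hg hfu hgv).linearExtend hle hχ

theorem linearExtend_remainder_sub {f g : BracketedPoly k X} (hf : leadingCoeff f = 1)
    (hg : leadingCoeff g = 1) (h : φ (leadingMonomial f) = ψ (leadingMonomial g)) :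
    linearExtend k φ (remainder f) - linearExtend k ψ (remainder g) =
      linearExtend k ψ g - linearExtend k φ f := by
  rw [sub_eq_sub_iff_add_eq_add, add_comm, linearExtend_add_remainder hf,
    linearExtend_add_remainder hg, h]

theorem isTrivialMod_sub_of_isResolvable (hS : ∀ s ∈ S, leadingCoeff s = 1)
    (hres : IsResolvable (MonoidAlgebra.basis (BracketedWord X) k) (rewritingSystem S))
    {f g : BracketedPoly k X} (hf : f ∈ S) (hg : g ∈ S) (hφ : IsContext φ) (hψ : IsContext ψ)
    (h : φ (leadingMonomial f) = ψ (leadingMonomial g)) :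
    IsTrivialMod S (φ (leadingMonomial f)) (linearExtend k φ f - linearExtend k ψ g) := by
  rw [isTrivialMod_iff_mem_relatorSpan hS, ← linearExtend_remainder_sub (hS g hg) (hS f hf) h.symm]
  exact hres _ _ _ (mem_rewritingSystem_iff.2 ⟨g, hg, ψ, hψ, Prod.ext h rfl⟩)
    (mem_rewritingSystem_iff.2 ⟨f, hf, φ, hφ, rfl⟩)

theorem isGroebnerShirshov_of_isResolvable (hS : ∀ s ∈ S, leadingCoeff s = 1)
    (hres : IsResolvable (MonoidAlgebra.basis (BracketedWord X) k) (rewritingSystem S)) :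
    IsGroebnerShirshov S := by
  refine ⟨?_, ?_⟩
  · rintro f hf g hg _ m n rfl hn - -
    rw [mul_mono, mono_mul]
    exact isTrivialMod_sub_of_isResolvable hS hres hf hg (φ := fun b => b * m)
      (.head m) (isContext_id.mul_left n) hn
  · rintro f hf g hg _ q rfl hq
    have h := isTrivialMod_sub_of_isResolvable hS hres hf hg isContext_id (isContext_plug q) hq
    rwa [linearExtend_id] at h

theorem IsGroebnerShirshov.isResolvable (hle : IsMonomialOrder X) (hGS : IsGroebnerShirshov S)
    (hS : ∀ s ∈ S, leadingCoeff s = 1) :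
    IsResolvable (MonoidAlgebra.basis (BracketedWord X) k) (rewritingSystem S) := by
  intro t v₁ v₂ h₁ h₂
  obtain ⟨f, hf, φ, hφ, hp⟩ := mem_rewritingSystem_iff.1 h₁
  obtain ⟨g, hg, ψ, hψ, hq⟩ := mem_rewritingSystem_iff.1 h₂
  obtain ⟨rfl, rfl⟩ := Prod.mk.inj hq
  obtain ⟨h, rfl⟩ := Prod.mk.inj hp
  rw [← isTrivialMod_iff_mem_relatorSpan hS, linearExtend_remainder_sub (hS f hf) (hS g hg) h.symm]
  exact hGS.isTrivialMod_of_relativeLocation hle hS (relativeLocation_of_apply_eq hψ hφ h) hg hf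
    rfl rfl

theorem isResolvable_rewritingSystem_iff (hle : IsMonomialOrder X)
    (hS : ∀ s ∈ S, leadingCoeff s = 1) :
    IsResolvable (MonoidAlgebra.basis (BracketedWord X) k) (rewritingSystem S) ↔
      IsGroebnerShirshov S :=
  ⟨isGroebnerShirshov_of_isResolvable hS, fun hGS => hGS.isResolvable hle hS⟩

end BracketedPoly

open BracketedPoly in
theorem mainTheorem3_general {k : Type v} {X : Type u} [CommRing k]
    [LinearOrder (BracketedWord X)] (hle : IsMonomialOrder X)
    (S : Set (BracketedPoly k X)) (hS : ∀ s ∈ S, leadingCoeff s = 1) :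
    List.TFAE
      [TermRewriting.Convergent (MonoidAlgebra.basis (BracketedWord X) k) (rewritingSystem S),
       TermRewriting.Confluent (MonoidAlgebra.basis (BracketedWord X) k) (rewritingSystem S),
       operatedIdeal S ⊓ irrSpan S = ⊥,
       IsCompl (operatedIdeal S) (irrSpan S),
       IsGroebnerShirshov S] := by
  have : WellFoundedLT (BracketedWord X) := ⟨hle.wellFounded⟩
  rw [← relatorSpan_rewritingSystem hS, ← normalForms_rewritingSystem,
    ← isResolvable_rewritingSystem_iff hle hS]
  exact (isDecreasing_rewritingSystem hle S).tfae

theorem mainTheorem3 {k : Type v} {X : Type u} [CommRing k] [IsDomain k] [Nonempty X]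
    [LinearOrder (BracketedWord X)] (hle : IsMonomialOrder X)
    (S : Set (BracketedPoly k X)) (hS : ∀ s ∈ S, BracketedPoly.IsMonic s) :
    List.TFAE
      [TermRewriting.Convergent (MonoidAlgebra.basis (BracketedWord X) k)
         (BracketedPoly.rewritingSystem S),
       TermRewriting.Confluent (MonoidAlgebra.basis (BracketedWord X) k)
         (BracketedPoly.rewritingSystem S),
       BracketedPoly.operatedIdeal S ⊓ BracketedPoly.irrSpan S = ⊥,
       IsCompl (BracketedPoly.operatedIdeal S) (BracketedPoly.irrSpan S),
       BracketedPoly.IsGroebnerShirshov S] := by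
  exact mainTheorem3_general hle S fun s hs => (hS s hs).2
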